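/- Let $G$ be a finite bipartite graph (parallel edges allowed) with colour classes $A$ and $B$, and let $b\colon V(G)\to\mathbb{Z}_{\ge 0}$. A \emph{$b$-matching} is a set $M\subseteq E(G)$ such that every vertex $v$ is incident with at most $b(v)$ edges of $M$; it is \emph{maximum} if it has the greatest number of edges among all $b$-matchings. An edge is \emph{forbidden} if it lies in no maximum $b$-matching, \emph{inevitable} if it lies in every maximum $b$-matching, and \emph{flexible} otherwise. A \emph{flexible component} is an induced subgraph $G[S]$, where $S$ is the vertex set of a connected component of the spanning subgraph $(V(G),\{\text{flexible edges}\})$; let $\mathcal{F}$ be the set of flexible components. Let $D$ be the set of vertices $v$ that are incident with fewer than $b(v)$ edges of $M$ for some maximum $b$-matching $M$. For $W\in\{A,B\}$, let $\mathcal{N}_W$ be the set of all $C\in\mathcal{F}$ such that either $V(C)\cap D\cap W\neq\emptyset$, or $V(C)=\{v\}$ with $b(v)=0$ and $v$ adjacent to a vertex of $D\cap W$ (the \emph{inconsistent flexible components hooked up by $W$}). For $C_1,C_2\in\mathcal{F}$ write $C_1\sqsubseteq_A C_2$ if $C_1=C_2$, or there is an inevitable edge between $V(C_1)\cap A$ and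 $V(C_2)\cap B$, or there is a forbidden edge between $V(C_2)\cap A$ and $V(C_1)\cap B$. Let $\preceq_A$ be the transitive closure of $\sqsubseteq_A$. A lower (upper) ideal of $(\mathcal{F},\preceq_A)$ is a downward (upward) closed subset, possibly empty. A lower ideal $\mathcal{I}$ is \emph{normalized} if $\mathcal{N}_A\subseteq\mathcal{I}$ and $\mathcal{N}_B\cap\mathcal{I}=\emptyset$; an upper ideal $\mathcal{J}$ is \emph{normalized} if $\mathcal{N}_B\subseteq\mathcal{J}$ and $\mathcal{N}_A\cap\mathcal{J}=\emptyset$. The pair is \emph{complementary} if $\mathcal{F}$ is the disjoint union of $\mathcal{I}$ and $\mathcal{J}$. A set $Z\subseteq V(G)$ is \emph{$b$-verifying} if it attains the minimum of $b(V(G)\setminus Z)+|E[Z]|$ over all subsets of $V(G)$, where $b(X)=\sum_{v\in X}b(v)$ and $E[Z]$ is the set of edges with both ends in $Z$. Then $(\mathcal{F},\preceq_A)$ is a partially ordered set, and a set $Z$ is $b$-verifying if and only if there is a complementary pair of a normalized lower ideal $\mathcal{I}_A$ and a normalized upper ideal $\mathcal{I}_B$ of $(\mathcal{F},\preceq_A)$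 such that $Z$ is the disjoint union of $Z_A$ and $Z_B$, where $$Z_A=\bigcup_{C\in\mathcal{I}_A}V(C)\cap A,\qquad Z_B=\bigcup_{C\in\mathcal{I}_B}V(C)\cap B.$$ -/

import Mathlib

open scoped Graph

namespace Graph

/-- `G` is bipartite with colour classes `A` and `B`: these partition the vertex set,
and every edge joins a vertex of `A` to a vertex of `B`.
Parallel edges are allowed; loops are excluded. -/
structure IsBipartition {α β : Type*} (G : Graph α β) (A B : Set α) : Prop where
  union_eq : A ∪ B = V(G)
  disjoint : Disjoint A B
  exists_isLink : ∀ e ∈ E(G), ∃ x ∈ A, ∃ y ∈ B, G.IsLink e x y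

/-- `E[Z]`: the set of edges both of whose ends are in `Z`. -/
def edgesWithin {α β : Type*} (G : Graph α β) (Z : Set α) : Set β :=
  {e | ∃ x ∈ Z, ∃ y ∈ Z, G.IsLink e x y}

/-- The set of neighbours of `X`: vertices outside `X` that are adjacent to a vertex in `X`. -/
def neighbours {α β : Type*} (G : Graph α β) (X : Set α) : Set α :=
  {v | v ∉ X ∧ ∃ x ∈ X, G.Adj x v}

/-- The union of the sets `V(H) ∩ W` over all members `H` of a set of graphs. -/
def projectiveUnion {α β : Type*} (I : Set (Graph α β)) (W : Set α) : Set α :=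
  ⋃ H ∈ I, V(H) ∩ W

/-! ### `b`-matchings -/

/-- A set `M` of edges such that every vertex `v` is incident with at most `b v` edges of `M`. -/
def IsBMatching {α β : Type*} (G : Graph α β) (b : α → ℕ) (M : Set β) : Prop :=
  M ⊆ E(G) ∧ ∀ v ∈ V(G), (G.incidenceSet v ∩ M).ncard ≤ b v

/-- A `b`-matching with the greatest number of edges. -/
def IsMaxBMatching {α β : Type*} (G : Graph α β) (b : α → ℕ) (M : Set β) : Prop :=
  G.IsBMatching b M ∧ ∀ N, G.IsBMatching b N → N.ncard ≤ M.ncard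

/-- An edge is allowed if it is contained in some maximum `b`-matching. -/
def IsAllowedEdge {α β : Type*} (G : Graph α β) (b : α → ℕ) (e : β) : Prop :=
  e ∈ E(G) ∧ ∃ M, G.IsMaxBMatching b M ∧ e ∈ M

/-- An edge is forbidden if it is not allowed. -/
def IsForbiddenEdge {α β : Type*} (G : Graph α β) (b : α → ℕ) (e : β) : Prop :=
  e ∈ E(G) ∧ ¬ G.IsAllowedEdge b e

/-- An allowed edge is inevitable if every maximum `b`-matching contains it. -/
def IsInevitableEdge {α β : Type*} (G : Graph α β) (b : α → ℕ) (e : β) : Prop :=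
  G.IsAllowedEdge b e ∧ ∀ M, G.IsMaxBMatching b M → e ∈ M

/-- An allowed edge is flexible if it is not inevitable. -/
def IsFlexibleEdge {α β : Type*} (G : Graph α β) (b : α → ℕ) (e : β) : Prop :=
  G.IsAllowedEdge b e ∧ ¬ G.IsInevitableEdge b e

/-- The vertices that are `M`-loose for some maximum `b`-matching `M`, that is, incident with
fewer than `b v` edges of `M`. -/
def looseVertices {α β : Type*} (G : Graph α β) (b : α → ℕ) : Set α :=
  {v | v ∈ V(G) ∧ ∃ M, G.IsMaxBMatching b M ∧ (G.incidenceSet v ∩ M).ncard < b v}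

/-! ### Flexible components -/

/-- The flexible components of `G`: the induced subgraphs `G[S]`, where `S` is the vertex set of a
connected component of the spanning subgraph whose edges are the flexible edges. -/
def flexComps {α β : Type*} (G : Graph α β) (b : α → ℕ) : Set (Graph α β) :=
  {C | ∃ x ∈ V(G), C = G.induce
    {y | y ∈ V(G) ∧ Relation.ReflTransGen (G.restrict {e | G.IsFlexibleEdge b e}).Adj x y}}

/-- A subgraph is loose if it has a vertex that is loose for some maximum `b`-matching. -/
def IsLooseSubgraph {α β : Type*} (G : Graph α β) (b : α → ℕ) (C : Graph α β) : Prop :=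
  (V(C) ∩ G.looseVertices b).Nonempty

/-- A subgraph is inconsistent if it is loose, or if it consists of a single vertex `v`
with `b v = 0` and `v` is a neighbour of the set of loose vertices. -/
def IsInconsistent {α β : Type*} (G : Graph α β) (b : α → ℕ) (C : Graph α β) : Prop :=
  G.IsLooseSubgraph b C ∨
    ∃ v, V(C) = {v} ∧ b v = 0 ∧ v ∈ G.neighbours (G.looseVertices b)

/-- An inconsistent subgraph is hooked up by `W` if it is loose and contains a loose vertex in `W`,
or if it consists of a single vertex `v` with `b v = 0` that is a neighbour of the set of
loose vertices in `W`. -/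
def IsHookedUpBy {α β : Type*} (G : Graph α β) (b : α → ℕ) (W : Set α) (C : Graph α β) : Prop :=
  (G.IsLooseSubgraph b C ∧ (V(C) ∩ G.looseVertices b ∩ W).Nonempty) ∨
    ∃ v, V(C) = {v} ∧ b v = 0 ∧ v ∈ G.neighbours (G.looseVertices b ∩ W)

/-- The inconsistent flexible components hooked up by `W`. -/
def inconsistentHookedUpBy {α β : Type*} (G : Graph α β) (b : α → ℕ) (W : Set α) :
    Set (G.flexComps b) :=
  {C | G.IsInconsistent b C.1 ∧ G.IsHookedUpBy b W C.1}

/-! ### The order on flexible components, and normalized ideals -/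

/-- The basic relation: `C = D`, or some inevitable edge joins `V(C) ∩ W` and `V(D) \ W`,
or some forbidden edge joins `V(D) ∩ W` and `V(C) \ W`. -/
def FlexStep {α β : Type*} (G : Graph α β) (b : α → ℕ) (W : Set α) (C D : G.flexComps b) : Prop :=
  C = D ∨
    (∃ e, G.IsInevitableEdge b e ∧ ∃ x ∈ V(C.1) ∩ W, ∃ y ∈ V(D.1) \ W, G.IsLink e x y) ∨
    (∃ e, G.IsForbiddenEdge b e ∧ ∃ x ∈ V(D.1) ∩ W, ∃ y ∈ V(C.1) \ W, G.IsLink e x y)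

/-- There is a finite chain of flexible components from `C` to `D`,
consecutive ones being related by `FlexStep`. -/
def FlexLE {α β : Type*} (G : Graph α β) (b : α → ℕ) (W : Set α) : (C D : G.flexComps b) → Prop :=
  Relation.ReflTransGen (G.FlexStep b W)

/-- A lower ideal of the flexible components ordered by `FlexLE b A` is a downward closed set
(possibly empty). It is normalized if it contains all inconsistent flexible components hooked up
by `A` and none of those hooked up by `B`. -/
structure IsNormalizedLowerIdeal {α β : Type*} (G : Graph α β) (b : α → ℕ) (A B : Set α)
    (I : Set (G.flexComps b)) : Prop where
  lower : ∀ C D, G.FlexLE b A C D → D ∈ I → C ∈ I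
  subset : G.inconsistentHookedUpBy b A ⊆ I
  disjoint : G.inconsistentHookedUpBy b B ∩ I = ∅

/-- An upper ideal of the flexible components ordered by `FlexLE b A` is an upward closed set
(possibly empty). It is normalized if it contains all inconsistent flexible components hooked up
by `B` and none of those hooked up by `A`. -/
structure IsNormalizedUpperIdeal {α β : Type*} (G : Graph α β) (b : α → ℕ) (A B : Set α)
    (J : Set (G.flexComps b)) : Prop where
  upper : ∀ C D, G.FlexLE b A C D → C ∈ J → D ∈ J
  disjoint : G.inconsistentHookedUpBy b A ∩ J = ∅
  subset : G.inconsistentHookedUpBy b B ⊆ J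

/-! ### Verifying sets -/

/-- The quantity `b(V(G) \ Z) + |E[Z]|`. -/
noncomputable def verifyingValue {α β : Type*} (G : Graph α β) (b : α → ℕ) (Z : Set α) : ℕ :=
  (∑ᶠ v ∈ V(G) \ Z, b v) + (G.edgesWithin Z).ncard

/-- A vertex set `Z` that attains the minimum of `b(V(G) \ Z) + |E[Z]|` over all vertex sets. -/
def IsVerifying {α β : Type*} (G : Graph α β) (b : α → ℕ) (Z : Set α) : Prop :=
  Z ⊆ V(G) ∧ ∀ Y ⊆ V(G), G.verifyingValue b Z ≤ G.verifyingValue b Y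

end Graph

/-!
Orient the problem by a cut. Every `Z ⊆ V(G)` corresponds to the side `X = (A ∩ Z) ∪ (B \ Z)`.
Edges of `E[Z]` leave `X` from its `A`-part, edges inside `V(G) \ Z` enter `X` into its `B`-part,
and all other edges of `G` stay on one side of `X`.

The engine is the minimax theorem `max |M| = min (b(V(G) \ Z) + |E[Z]|)`
(`exists_isBMatching_verifyingValue_le`). It is proved in cover form
(`exists_coverCost_le_card`) by induction on the edges: if neither deleting an edge nor using it
preserves the minimum, then two covers arise whose uncrossing is too cheap. By complementary
slackness, `Z` is verifying if and only if, for one or for every maximum `b`-matching `M`, one has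
`E[Z] ⊆ M`, no edge of `M` lies inside `V(G) \ Z`, and all vertices outside `Z` are saturated
(`IsMaxBMatching.isVerifying_iff_slackness`).

Hence the cut `X` of a verifying set is a `Graph.IsSlackCut`: the edges leaving its `A`-part are
inevitable, those entering its `B`-part are forbidden. No flexible edge crosses such a cut, so it is
a union of flexible components, and its members form a lower ideal by the very definition of
`FlexStep`; saturation outside `Z` makes the ideal normalized. Conversely, an edge violating
slackness for the set built from a complementary pair of ideals would join two different components
and give a `FlexStep` that leaves the lower ideal.

For antisymmetry it suffices to separate the two components of any nontrivial `FlexStep` by a slack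
cut (`exists_isSlackCut_of_flexStep`), because all components of a cycle lie on the same side of each
slack cut. A strict form of complementary slackness supplies the cut: applying the minimax theorem
after deleting an inevitable edge gives a verifying set containing both its ends, and applying it
after deleting a forbidden edge and lowering `b` by one at both its ends gives a verifying set that
avoids both ends. The latter needs `b` to be positive at the ends; an end with `b = 0` meets only
forbidden edges, and then the end alone, or its complement, is a slack cut.
-/

/-! ### Minimum covers and uncrossing -/

section Cover

open Finset

variable {β γ δ : Type*} [DecidableEq γ] [DecidableEq δ]

/-- A set of vertices on each side covers the edges meeting it; every edge that remains uncovered is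
paid for individually. `coverCost` is the total price of `P` on the left, `Q` on the right and the
edges of `F` left over, where the edge `e` has left end `s e` and right end `t e`. The two sides have
separate types, so no disjointness is required. -/
def coverCost (F : Finset β) (s : β → γ) (t : β → δ) (p : γ → ℕ) (q : δ → ℕ)
    (P : Finset γ) (Q : Finset δ) : ℕ :=
  ∑ v ∈ P, p v + ∑ v ∈ Q, q v + #{e ∈ F | s e ∉ P ∧ t e ∉ Q}

theorem coverCost_insert [DecidableEq β] {F : Finset β} {e : β} (he : e ∉ F) (s : β → γ)
    (t : β → δ) (p : γ → ℕ)
    (q : δ → ℕ) (P : Finset γ) (Q : Finset δ) :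
    coverCost (insert e F) s t p q P Q =
      coverCost F s t p q P Q + if s e ∉ P ∧ t e ∉ Q then 1 else 0 := by
  unfold coverCost
  rw [filter_insert]
  split_ifs with h
  · rw [card_insert_of_notMem (by simp [he])]; ring
  · simp

/-- Submodularity of the cost, in the lattice order that is reversed on the right-hand side. -/
theorem coverCost_uncross (F : Finset β) (s : β → γ) (t : β → δ) (p : γ → ℕ) (q : δ → ℕ)
    (P₁ P₂ : Finset γ) (Q₁ Q₂ : Finset δ) :
    coverCost F s t p q (P₁ ∪ P₂) (Q₁ ∩ Q₂) + coverCost F s t p q (P₁ ∩ P₂) (Q₁ ∪ Q₂) ≤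
      coverCost F s t p q P₁ Q₁ + coverCost F s t p q P₂ Q₂ := by
  have hP := sum_union_inter (s₁ := P₁) (s₂ := P₂) (f := p)
  have hQ := sum_union_inter (s₁ := Q₁) (s₂ := Q₂) (f := q)
  have hF : #{e ∈ F | s e ∉ P₁ ∪ P₂ ∧ t e ∉ Q₁ ∩ Q₂} + #{e ∈ F | s e ∉ P₁ ∩ P₂ ∧ t e ∉ Q₁ ∪ Q₂}
      ≤ #{e ∈ F | s e ∉ P₁ ∧ t e ∉ Q₁} + #{e ∈ F | s e ∉ P₂ ∧ t e ∉ Q₂} := by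
    simp only [card_filter, ← sum_add_distrib]
    refine sum_le_sum fun e _ => ?_
    simp only [mem_union, mem_inter]
    by_cases h1 : s e ∈ P₁ <;> by_cases h2 : s e ∈ P₂ <;> by_cases h3 : t e ∈ Q₁ <;>
      by_cases h4 : t e ∈ Q₂ <;> simp [h1, h2, h3, h4]
  unfold coverCost
  omega

theorem coverCost_insert_left_le (F : Finset β) (s : β → γ) (t : β → δ) {p : γ → ℕ} (q : δ → ℕ)
    (P : Finset γ) (Q : Finset δ) {x : γ} (hx : p x = 0) :
    coverCost F s t p q (insert x P) Q ≤ coverCost F s t p q P Q := by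
  unfold coverCost
  have h : #{e ∈ F | s e ∉ insert x P ∧ t e ∉ Q} ≤ #{e ∈ F | s e ∉ P ∧ t e ∉ Q} :=
    card_le_card (monotone_filter_right _ fun e _ => by simp; tauto)
  have hs : ∑ v ∈ insert x P, p v = ∑ v ∈ P, p v := sum_insert_of_eq_zero_if_notMem fun _ => hx
  omega

theorem coverCost_insert_right_le (F : Finset β) (s : β → γ) (t : β → δ) (p : γ → ℕ) {q : δ → ℕ}
    (P : Finset γ) (Q : Finset δ) {y : δ} (hy : q y = 0) :
    coverCost F s t p q P (insert y Q) ≤ coverCost F s t p q P Q := by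
  unfold coverCost
  have h : #{e ∈ F | s e ∉ P ∧ t e ∉ insert y Q} ≤ #{e ∈ F | s e ∉ P ∧ t e ∉ Q} :=
    card_le_card (monotone_filter_right _ fun e _ => by simp; tauto)
  have hs : ∑ v ∈ insert y Q, q v = ∑ v ∈ Q, q v := sum_insert_of_eq_zero_if_notMem fun _ => hy
  omega

theorem sum_eq_sum_update_pred_add (p : γ → ℕ) {x : γ} (hx : p x ≠ 0) (P : Finset γ) :
    ∑ v ∈ P, p v = ∑ v ∈ P, Function.update p x (p x - 1) v + if x ∈ P then 1 else 0 := by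
  rw [← sum_ite_eq P x (fun _ => 1), ← sum_add_distrib]
  refine sum_congr rfl fun v _ => ?_
  by_cases h : x = v
  · subst h; simp; omega
  · simp [h, Function.update_of_ne (Ne.symm h)]

theorem coverCost_eq_coverCost_update (F : Finset β) (s : β → γ) (t : β → δ) {p : γ → ℕ}
    {q : δ → ℕ} {x : γ} {y : δ} (hx : p x ≠ 0) (hy : q y ≠ 0) (P : Finset γ) (Q : Finset δ) :
    coverCost F s t p q P Q =
      coverCost F s t (Function.update p x (p x - 1)) (Function.update q y (q y - 1)) P Q +
        ((if x ∈ P then 1 else 0) + if y ∈ Q then 1 else 0) := by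
  unfold coverCost
  rw [sum_eq_sum_update_pred_add p hx, sum_eq_sum_update_pred_add q hy]
  ring

theorem card_filter_insert_le_of_update [DecidableEq β] {M : Finset β} {e : β} {f : β → γ}
    {p : γ → ℕ}
    (hp : p (f e) ≠ 0)
    (h : ∀ v, #{i ∈ M | f i = v} ≤ Function.update p (f e) (p (f e) - 1) v) (v : γ) :
    #{i ∈ insert e M | f i = v} ≤ p v := by
  have hv := h v
  rw [filter_insert]
  split_ifs with hev
  · subst hev
    rw [Function.update_self] at hv
    have := card_insert_le e {i ∈ M | f i = f e}
    omega
  · rwa [Function.update_of_ne (Ne.symm hev)] at hv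

/-- The nontrivial half of the minimax theorem: some matching is as large as the cost of some
cover. -/
theorem exists_coverCost_le_card [DecidableEq β] (F : Finset β) (s : β → γ) (t : β → δ)
    (p : γ → ℕ) (q : δ → ℕ) :
    ∃ M ⊆ F, (∀ v, #{e ∈ M | s e = v} ≤ p v) ∧ (∀ v, #{e ∈ M | t e = v} ≤ q v) ∧
      ∃ P Q, coverCost F s t p q P Q ≤ #M := by
  induction F using Finset.induction_on generalizing p q with
  | empty => exact ⟨∅, by simp, by simp, by simp, ∅, ∅, by simp [coverCost]⟩
  | insert e F he ih =>
    obtain ⟨M₁, hM₁, hp₁, hq₁, P₁, Q₁, h₁⟩ := ih p q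
    have hM₁' := hM₁.trans (subset_insert e F)
    by_cases hs : s e ∈ P₁ ∨ t e ∈ Q₁
    · refine ⟨M₁, hM₁', hp₁, hq₁, P₁, Q₁, ?_⟩
      rwa [coverCost_insert he, if_neg (by tauto)]
    push Not at hs
    -- An end of capacity zero can be added to the cover for free, which then covers `e`.
    by_cases hp : p (s e) = 0
    · refine ⟨M₁, hM₁', hp₁, hq₁, insert (s e) P₁, Q₁, ?_⟩
      rw [coverCost_insert he, if_neg (by simp)]
      exact (coverCost_insert_left_le F s t q P₁ Q₁ hp).trans h₁
    by_cases hq : q (t e) = 0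
    · refine ⟨M₁, hM₁', hp₁, hq₁, P₁, insert (t e) Q₁, ?_⟩
      rw [coverCost_insert he, if_neg (by simp)]
      exact (coverCost_insert_right_le F s t p P₁ Q₁ hq).trans h₁
    obtain ⟨M₂, hM₂, hp₂, hq₂, P₂, Q₂, h₂⟩ := ih (Function.update p (s e) (p (s e) - 1))
      (Function.update q (t e) (q (t e) - 1))
    have hM₂' : insert e M₂ ⊆ insert e F := insert_subset_insert e hM₂
    have hp₂' := card_filter_insert_le_of_update hp hp₂
    have hq₂' := card_filter_insert_le_of_update hq hq₂
    have hcard : #(insert e M₂) = #M₂ + 1 := card_insert_of_notMem fun h => he (hM₂ h)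
    have hup := coverCost_eq_coverCost_update F s t hp hq P₂ Q₂
    by_cases hs₂ : s e ∈ P₂ ∧ t e ∈ Q₂
    -- The first cover misses `e` and the second one covers it twice, so that both uncrossed covers
    -- cover `e`. Together they cost at most `#M₁ + #M₂ + 2`, hence one of them costs
    -- at most the larger of `#M₁` and `#M₂ + 1`.
    · have hun := coverCost_uncross F s t p q P₁ P₂ Q₁ Q₂
      rw [if_pos hs₂.1, if_pos hs₂.2] at hup
      have hcu := coverCost_insert he s t p q (P₁ ∪ P₂) (Q₁ ∩ Q₂)
      have hci := coverCost_insert he s t p q (P₁ ∩ P₂) (Q₁ ∪ Q₂)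
      rw [if_neg (by simp [hs₂])] at hcu hci
      by_cases hle : #M₁ ≤ #M₂ + 1
      · refine ⟨insert e M₂, hM₂', hp₂', hq₂', ?_⟩
        by_cases hu : coverCost (insert e F) s t p q (P₁ ∪ P₂) (Q₁ ∩ Q₂) ≤ #(insert e M₂)
        · exact ⟨_, _, hu⟩
        · exact ⟨P₁ ∩ P₂, Q₁ ∪ Q₂, by omega⟩
      · refine ⟨M₁, hM₁', hp₁, hq₁, ?_⟩
        by_cases hu : coverCost (insert e F) s t p q (P₁ ∪ P₂) (Q₁ ∩ Q₂) ≤ #M₁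
        · exact ⟨_, _, hu⟩
        · exact ⟨P₁ ∩ P₂, Q₁ ∪ Q₂, by omega⟩
    · refine ⟨insert e M₂, hM₂', hp₂', hq₂', P₂, Q₂, ?_⟩
      rw [coverCost_insert he, hcard, hup]
      by_cases h1 : s e ∈ P₂ <;> by_cases h2 : t e ∈ Q₂ <;> simp_all

/-- Double counting of the edges of `M`, from which both weak duality and its equality case are read
off. -/
theorem card_add_card_eq_sum [DecidableEq β] (F : Finset β) (s : β → γ) (t : β → δ) {M : Finset β}
    (hM : M ⊆ F)
    (P : Finset γ) (Q : Finset δ) :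
    #M + #{e ∈ M | s e ∈ P ∧ t e ∈ Q} + #{e ∈ F \ M | s e ∉ P ∧ t e ∉ Q} =
      ∑ v ∈ P, #{e ∈ M | s e = v} + ∑ v ∈ Q, #{e ∈ M | t e = v} +
        #{e ∈ F | s e ∉ P ∧ t e ∉ Q} := by
  have hP : ∑ v ∈ P, #{e ∈ M | s e = v} = #{e ∈ M | s e ∈ P} := by
    rw [card_eq_sum_card_fiberwise (f := s) (t := P) (fun e he => by simpa using (mem_filter.1 he).2)]
    refine sum_congr rfl fun v hv => congrArg card ?_
    ext e; simp; rintro rfl _; exact hv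
  have hQ : ∑ v ∈ Q, #{e ∈ M | t e = v} = #{e ∈ M | t e ∈ Q} := by
    rw [card_eq_sum_card_fiberwise (f := t) (t := Q) (fun e he => by simpa using (mem_filter.1 he).2)]
    refine sum_congr rfl fun v hv => congrArg card ?_
    ext e; simp; rintro rfl _; exact hv
  have hF : #{e ∈ F | s e ∉ P ∧ t e ∉ Q} =
      #{e ∈ F \ M | s e ∉ P ∧ t e ∉ Q} + #{e ∈ M | s e ∉ P ∧ t e ∉ Q} := by
    simp only [card_filter]
    exact (sum_sdiff hM).symm
  have hMM : #M + #{e ∈ M | s e ∈ P ∧ t e ∈ Q} =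
      #{e ∈ M | s e ∈ P} + #{e ∈ M | t e ∈ Q} + #{e ∈ M | s e ∉ P ∧ t e ∉ Q} := by
    rw [card_eq_sum_ones]
    simp only [card_filter, ← sum_add_distrib]
    refine sum_congr rfl fun e _ => ?_
    by_cases h1 : s e ∈ P <;> by_cases h2 : t e ∈ Q <;> simp [h1, h2]
  omega

/-- Weak duality. -/
theorem card_le_coverCost [DecidableEq β] {F M : Finset β} {s : β → γ} {t : β → δ} {p : γ → ℕ}
    {q : δ → ℕ}
    (hM : M ⊆ F) {P : Finset γ} {Q : Finset δ} (hp : ∀ v ∈ P, #{e ∈ M | s e = v} ≤ p v)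
    (hq : ∀ v ∈ Q, #{e ∈ M | t e = v} ≤ q v) :
    #M ≤ coverCost F s t p q P Q := by
  have h := card_add_card_eq_sum F s t hM P Q
  have h1 := sum_le_sum hp
  have h2 := sum_le_sum hq
  unfold coverCost
  omega

/-- The equality case of weak duality: complementary slackness. -/
theorem coverCost_le_card_iff [DecidableEq β] {F M : Finset β} {s : β → γ} {t : β → δ} {p : γ → ℕ}
    {q : δ → ℕ}
    (hM : M ⊆ F) {P : Finset γ} {Q : Finset δ} (hp : ∀ v ∈ P, #{e ∈ M | s e = v} ≤ p v)
    (hq : ∀ v ∈ Q, #{e ∈ M | t e = v} ≤ q v) :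
    coverCost F s t p q P Q ≤ #M ↔
      (∀ v ∈ P, #{e ∈ M | s e = v} = p v) ∧ (∀ v ∈ Q, #{e ∈ M | t e = v} = q v) ∧
      (∀ e ∈ F, s e ∉ P → t e ∉ Q → e ∈ M) ∧ ∀ e ∈ M, ¬ (s e ∈ P ∧ t e ∈ Q) := by
  have h := card_add_card_eq_sum F s t hM P Q
  have h1 := sum_le_sum hp
  have h2 := sum_le_sum hq
  rw [← sum_eq_sum_iff_of_le hp, ← sum_eq_sum_iff_of_le hq]
  have h3 : (∀ e ∈ F, s e ∉ P → t e ∉ Q → e ∈ M) ↔ #{e ∈ F \ M | s e ∉ P ∧ t e ∉ Q} = 0 := by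
    rw [card_eq_zero, filter_eq_empty_iff]
    simp only [mem_sdiff]
    exact ⟨fun h e he hc => he.2 (h e he.1 hc.1 hc.2),
      fun h e he hs ht => by_contra fun hn => h ⟨he, hn⟩ ⟨hs, ht⟩⟩
  have h4 : (∀ e ∈ M, ¬ (s e ∈ P ∧ t e ∈ Q)) ↔ #{e ∈ M | s e ∈ P ∧ t e ∈ Q} = 0 := by
    rw [card_eq_zero, filter_eq_empty_iff]
  rw [h3, h4]
  unfold coverCost
  omega

end Cover

namespace Graph

variable {α β : Type*} {G : Graph α β} {A B X Z : Set α} {M : Set β} {b : α → ℕ} {e : β}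

/-! ### The minimax theorem for bipartite graphs -/

/-- A simultaneous choice of the two ends of every edge, with junk values off `E(G)`; a vertex is
needed for the latter. -/
theorem IsBipartition.exists_ends [Nonempty α] (hAB : G.IsBipartition A B) :
    ∃ s t : β → α, ∀ e ∈ E(G), s e ∈ A ∧ t e ∈ B ∧ G.IsLink e (s e) (t e) := by
  have h := hAB.exists_isLink
  choose! s hs t ht hl using h
  exact ⟨s, t, fun e he => ⟨hs e he, ht e he, hl e he⟩⟩

theorem IsBipartition.inc_left_iff (hAB : G.IsBipartition A B) {s t : β → α}
    (hst : ∀ e ∈ E(G), s e ∈ A ∧ t e ∈ B ∧ G.IsLink e (s e) (t e)) {e : β} (he : e ∈ E(G)) {v : α}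
    (hv : v ∈ A) : G.Inc e v ↔ s e = v := by
  obtain ⟨_, ht, hl⟩ := hst e he
  refine ⟨fun h => ?_, fun h => h ▸ hl.inc_left⟩
  rcases h.eq_or_eq_of_isLink hl with rfl | rfl
  · rfl
  · exact (hAB.disjoint.le_bot ⟨hv, ht⟩).elim

theorem IsBipartition.inc_right_iff (hAB : G.IsBipartition A B) {s t : β → α}
    (hst : ∀ e ∈ E(G), s e ∈ A ∧ t e ∈ B ∧ G.IsLink e (s e) (t e)) {e : β} (he : e ∈ E(G)) {v : α}
    (hv : v ∈ B) : G.Inc e v ↔ t e = v := by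
  obtain ⟨hs, _, hl⟩ := hst e he
  refine ⟨fun h => ?_, fun h => h ▸ hl.inc_right⟩
  rcases h.eq_or_eq_of_isLink hl with rfl | rfl
  · exact (hAB.disjoint.le_bot ⟨hs, hv⟩).elim
  · rfl

theorem IsBipartition.mem_left_of_isLink (hAB : G.IsBipartition A B) {e : β} {x y : α}
    (h : G.IsLink e x y) (hx : x ∈ B) : y ∈ A := by
  obtain ⟨u, hu, w, hw, hl⟩ := hAB.exists_isLink e h.edge_mem
  rcases h.eq_and_eq_or_eq_and_eq hl with ⟨rfl, rfl⟩ | ⟨rfl, rfl⟩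
  · exact (hAB.disjoint.le_bot ⟨hu, hx⟩).elim
  · exact hu

theorem IsBipartition.mem_right_of_isLink (hAB : G.IsBipartition A B) {e : β} {x y : α}
    (h : G.IsLink e x y) (hx : x ∈ A) : y ∈ B := by
  obtain ⟨u, hu, w, hw, hl⟩ := hAB.exists_isLink e h.edge_mem
  rcases h.eq_and_eq_or_eq_and_eq hl with ⟨rfl, rfl⟩ | ⟨rfl, rfl⟩
  · exact hw
  · exact (hAB.disjoint.le_bot ⟨hx, hw⟩).elim

theorem edgesWithin_subset_edgeSet (G : Graph α β) (Z : Set α) : G.edgesWithin Z ⊆ E(G) := by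
  rintro e ⟨x, -, y, -, h⟩
  exact h.edge_mem

section Ends

open Classical Finset

theorem ncard_incidenceSet_inter_left (hAB : G.IsBipartition A B) {s t : β → α}
    (hst : ∀ e ∈ E(G), s e ∈ A ∧ t e ∈ B ∧ G.IsLink e (s e) (t e)) {M : Finset β}
    (hM : (M : Set β) ⊆ E(G)) {v : α} (hv : v ∈ A) :
    (G.incidenceSet v ∩ M).ncard = #{e ∈ M | s e = v} := by
  rw [← Set.ncard_coe_finset]
  congr 1
  ext e
  simp only [Set.mem_inter_iff, mem_incidenceSet, coe_filter, Set.mem_ofPred_eq, mem_coe]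
  rw [and_comm]
  exact and_congr_right fun he => hAB.inc_left_iff hst (hM he) hv

theorem ncard_incidenceSet_inter_right (hAB : G.IsBipartition A B) {s t : β → α}
    (hst : ∀ e ∈ E(G), s e ∈ A ∧ t e ∈ B ∧ G.IsLink e (s e) (t e)) {M : Finset β}
    (hM : (M : Set β) ⊆ E(G)) {v : α} (hv : v ∈ B) :
    (G.incidenceSet v ∩ M).ncard = #{e ∈ M | t e = v} := by
  rw [← Set.ncard_coe_finset]
  congr 1
  ext e
  simp only [Set.mem_inter_iff, mem_incidenceSet, coe_filter, Set.mem_ofPred_eq, mem_coe]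
  rw [and_comm]
  exact and_congr_right fun he => hAB.inc_right_iff hst (hM he) hv

theorem mem_edgesWithin_iff {s t : β → α} {e : β} (he : G.IsLink e (s e) (t e)) :
    e ∈ G.edgesWithin Z ↔ s e ∈ Z ∧ t e ∈ Z := by
  refine ⟨?_, fun h => ⟨_, h.1, _, h.2, he⟩⟩
  rintro ⟨x, hx, y, hy, h⟩
  rcases he.eq_and_eq_or_eq_and_eq h with ⟨h1, h2⟩ | ⟨h1, h2⟩ <;> simp [h1, h2, hx, hy]

/-- The value of `Z` is the cost of the cover by the vertices outside `Z`. -/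
theorem verifyingValue_eq_coverCost {V₁ V₂ : Finset α} {F : Finset β}
    (hAB : G.IsBipartition (V₁ : Set α) (V₂ : Set α)) (hF : (F : Set β) = E(G)) {s t : β → α}
    (hst : ∀ e ∈ E(G), s e ∈ (V₁ : Set α) ∧ t e ∈ (V₂ : Set α) ∧ G.IsLink e (s e) (t e))
    (b : α → ℕ) (Z : Set α) :
    G.verifyingValue b Z =
      coverCost F s t b b {v ∈ V₁ | v ∉ Z} {v ∈ V₂ | v ∉ Z} := by
  unfold verifyingValue coverCost
  congr 1
  · have hd : Disjoint {v ∈ V₁ | v ∉ Z} {v ∈ V₂ | v ∉ Z} :=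
      disjoint_filter_filter (disjoint_coe.1 hAB.disjoint)
    have hset : V(G) \ Z = ↑({v ∈ V₁ | v ∉ Z} ∪ {v ∈ V₂ | v ∉ Z}) := by
      ext v
      simp [← hAB.union_eq, ← filter_union]
    rw [← sum_union hd, hset, finsum_mem_coe_finset]
  · rw [← Set.ncard_coe_finset]
    congr 1
    ext e
    by_cases he : e ∈ E(G)
    · obtain ⟨h1, h2, hl⟩ := hst e he
      have heF : e ∈ F := by rw [← mem_coe, hF]; exact he
      rw [mem_edgesWithin_iff hl]
      simp only [mem_coe] at h1 h2
      simp [heF, h1, h2]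
    · have heF : e ∉ F := by rw [← mem_coe, hF]; exact he
      simpa [heF] using fun h => he (G.edgesWithin_subset_edgeSet Z h)

/-- The minimax theorem, up to weak duality. -/
theorem exists_isBMatching_verifyingValue_le [Nonempty α] (hV : V(G).Finite) (hE : E(G).Finite)
    (hAB : G.IsBipartition A B) (b : α → ℕ) :
    ∃ M Z, G.IsBMatching b M ∧ Z ⊆ V(G) ∧ G.verifyingValue b Z ≤ M.ncard := by
  obtain ⟨s, t, hst⟩ := hAB.exists_ends
  obtain ⟨V₁, rfl⟩ := (hV.subset (hAB.union_eq ▸ Set.subset_union_left)).exists_finset_coe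
  obtain ⟨V₂, rfl⟩ := (hV.subset (hAB.union_eq ▸ Set.subset_union_right)).exists_finset_coe
  obtain ⟨F, hF⟩ := hE.exists_finset_coe
  obtain ⟨M, hM, hs, ht, P, Q, hPQ⟩ := exists_coverCost_le_card F s t b b
  have hME : (M : Set β) ⊆ E(G) := hF ▸ (coe_subset.2 hM)
  refine ⟨M, (V₁ \ P ∪ V₂ \ Q : Finset α), ⟨hME, fun v hv => ?_⟩, ?_, ?_⟩
  · rw [← hAB.union_eq] at hv
    rcases hv with hv | hv
    · rw [ncard_incidenceSet_inter_left hAB hst hME hv]; exact hs v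
    · rw [ncard_incidenceSet_inter_right hAB hst hME hv]; exact ht v
  · rw [← hAB.union_eq, ← coe_union, coe_subset]
    exact union_subset_union sdiff_subset sdiff_subset
  · rw [Set.ncard_coe_finset, verifyingValue_eq_coverCost hAB hF hst]
    refine le_trans ?_ hPQ
    have hd : ∀ v ∈ V₁, v ∉ V₂ := fun v h h' => hAB.disjoint.le_bot ⟨h, h'⟩
    unfold coverCost
    refine add_le_add (add_le_add (sum_le_sum_of_subset ?_) (sum_le_sum_of_subset ?_))
      (card_le_card ?_)
    · intro v hv
      simp only [mem_filter, coe_union, Set.mem_union, mem_coe, mem_sdiff] at hv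
      tauto
    · intro v hv
      simp only [mem_filter, coe_union, Set.mem_union, mem_coe, mem_sdiff] at hv
      tauto
    · intro e he
      have heE : e ∈ E(G) := by rw [← hF]; exact (mem_filter.1 he).1
      obtain ⟨h1, h2, -⟩ := hst e heE
      simp only [mem_coe] at h1 h2
      have h3 := hd _ h1
      have h4 : t e ∉ V₁ := fun h => hd _ h h2
      simp only [mem_filter, coe_union, Set.mem_union, mem_coe, mem_sdiff, h1, h2, h3, h4] at he ⊢
      tauto

/-- Weak duality between `b`-matchings and vertex sets, together with its equality case. -/
theorem IsBMatching.ncard_le_verifyingValue_and_iff [Nonempty α] (hM : G.IsBMatching b M)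
    (hV : V(G).Finite) (hE : E(G).Finite) (hAB : G.IsBipartition A B) (Z : Set α) :
    M.ncard ≤ G.verifyingValue b Z ∧ (G.verifyingValue b Z ≤ M.ncard ↔
      (∀ v ∈ V(G) \ Z, (G.incidenceSet v ∩ M).ncard = b v) ∧ G.edgesWithin Z ⊆ M ∧
      ∀ e ∈ M, ∀ x y, G.IsLink e x y → x ∈ Z ∨ y ∈ Z) := by
  obtain ⟨s, t, hst⟩ := hAB.exists_ends
  obtain ⟨V₁, rfl⟩ := (hV.subset (hAB.union_eq ▸ Set.subset_union_left)).exists_finset_coe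
  obtain ⟨V₂, rfl⟩ := (hV.subset (hAB.union_eq ▸ Set.subset_union_right)).exists_finset_coe
  obtain ⟨F, hF⟩ := hE.exists_finset_coe
  obtain ⟨M, rfl⟩ := (hE.subset hM.1).exists_finset_coe
  have hME := hM.1
  have hMF : M ⊆ F := by rw [← coe_subset, hF]; exact hME
  have hdeg := hM.2
  rw [← hAB.union_eq] at hdeg
  have hp : ∀ v ∈ ({v ∈ V₁ | v ∉ Z} : Finset α), #{e ∈ M | s e = v} ≤ b v := fun v hv => by
    have hv' := (mem_filter.1 hv).1
    rw [← ncard_incidenceSet_inter_left hAB hst hME hv']; exact hdeg v (Or.inl hv')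
  have hq : ∀ v ∈ ({v ∈ V₂ | v ∉ Z} : Finset α), #{e ∈ M | t e = v} ≤ b v := fun v hv => by
    have hv' := (mem_filter.1 hv).1
    rw [← ncard_incidenceSet_inter_right hAB hst hME hv']; exact hdeg v (Or.inr hv')
  rw [verifyingValue_eq_coverCost hAB hF hst, Set.ncard_coe_finset]
  refine ⟨card_le_coverCost hMF hp hq, ?_⟩
  rw [coverCost_le_card_iff hMF hp hq, ← and_assoc]
  refine and_congr ?_ (and_congr ?_ ?_)
  · rw [← hAB.union_eq]
    constructor
    · rintro ⟨h1, h2⟩ v ⟨hv | hv, hvZ⟩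
      · rw [ncard_incidenceSet_inter_left hAB hst hME hv]; exact h1 v (mem_filter.2 ⟨hv, hvZ⟩)
      · rw [ncard_incidenceSet_inter_right hAB hst hME hv]; exact h2 v (mem_filter.2 ⟨hv, hvZ⟩)
    · refine fun h => ⟨fun v hv => ?_, fun v hv => ?_⟩ <;> obtain ⟨hv, hvZ⟩ := mem_filter.1 hv
      · rw [← ncard_incidenceSet_inter_left hAB hst hME hv]; exact h v ⟨Or.inl hv, hvZ⟩
      · rw [← ncard_incidenceSet_inter_right hAB hst hME hv]; exact h v ⟨Or.inr hv, hvZ⟩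
  · have hiff : ∀ e ∈ F, (e ∈ G.edgesWithin Z ↔
        s e ∉ ({v ∈ V₁ | v ∉ Z} : Finset α) ∧ t e ∉ ({v ∈ V₂ | v ∉ Z} : Finset α)) := by
      intro e he
      obtain ⟨h1, h2, hl⟩ := hst e (hF ▸ he)
      rw [mem_edgesWithin_iff hl]
      simp only [mem_coe] at h1 h2
      simp [h1, h2]
    refine ⟨fun h e he => ?_, fun h e he h1 h2 => h ((hiff e he).2 ⟨h1, h2⟩)⟩
    have heF : e ∈ F := by rw [← mem_coe, hF]; exact G.edgesWithin_subset_edgeSet Z he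
    exact h e heF ((hiff e heF).1 he).1 ((hiff e heF).1 he).2
  · refine forall₂_congr fun e he => ?_
    obtain ⟨h1, h2, hl⟩ := hst e (hME he)
    simp only [mem_coe] at h1 h2
    simp only [mem_filter, h1, h2, true_and]
    constructor
    · intro h x y hxy
      rcases hxy.eq_and_eq_or_eq_and_eq hl with ⟨rfl, rfl⟩ | ⟨rfl, rfl⟩ <;> tauto
    · intro h
      have := h _ _ hl
      tauto

end Ends

/-! ### Complementary slackness and its strict form -/

theorem exists_isMaxBMatching_isVerifying [Nonempty α] (hV : V(G).Finite) (hE : E(G).Finite)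
    (hAB : G.IsBipartition A B) (b : α → ℕ) :
    ∃ M Z, G.IsMaxBMatching b M ∧ Z ⊆ V(G) ∧ G.verifyingValue b Z ≤ M.ncard := by
  obtain ⟨M, Z, hM, hZ, hle⟩ := exists_isBMatching_verifyingValue_le hV hE hAB b
  exact ⟨M, Z, ⟨hM, fun N hN =>
    (hN.ncard_le_verifyingValue_and_iff hV hE hAB Z).1.trans hle⟩, hZ, hle⟩

theorem IsMaxBMatching.isVerifying_iff [Nonempty α] (hM : G.IsMaxBMatching b M)
    (hV : V(G).Finite) (hE : E(G).Finite) (hAB : G.IsBipartition A B) (hZ : Z ⊆ V(G)) :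
    G.IsVerifying b Z ↔ G.verifyingValue b Z ≤ M.ncard := by
  constructor
  · rintro ⟨-, h⟩
    obtain ⟨N, Y, hN, hY, hle⟩ := exists_isMaxBMatching_isVerifying hV hE hAB b
    exact ((h Y hY).trans hle).trans (hM.2 N hN.1)
  · exact fun h => ⟨hZ, fun Y _ =>
      h.trans (hM.1.ncard_le_verifyingValue_and_iff hV hE hAB Y).1⟩

theorem IsMaxBMatching.isVerifying_iff_slackness [Nonempty α] (hM : G.IsMaxBMatching b M)
    (hV : V(G).Finite) (hE : E(G).Finite) (hAB : G.IsBipartition A B) (hZ : Z ⊆ V(G)) :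
    G.IsVerifying b Z ↔
      (∀ v ∈ V(G) \ Z, (G.incidenceSet v ∩ M).ncard = b v) ∧ G.edgesWithin Z ⊆ M ∧
      ∀ e ∈ M, ∀ x y, G.IsLink e x y → x ∈ Z ∨ y ∈ Z := by
  rw [hM.isVerifying_iff hV hE hAB hZ]
  exact (hM.1.ncard_le_verifyingValue_and_iff hV hE hAB Z).2

theorem IsBipartition.deleteEdges (hAB : G.IsBipartition A B) (S : Set β) :
    (G.deleteEdges S).IsBipartition A B := by
  refine ⟨by simpa using hAB.union_eq, hAB.disjoint, fun e he => ?_⟩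
  rw [edgeSet_deleteEdges] at he
  obtain ⟨x, hx, y, hy, h⟩ := hAB.exists_isLink e he.1
  exact ⟨x, hx, y, hy, by simpa using ⟨h, he.2⟩⟩

theorem incidenceSet_deleteEdges_inter {S : Set β} (hM : M ⊆ E(G.deleteEdges S)) (v : α) :
    (G.deleteEdges S).incidenceSet v ∩ M = G.incidenceSet v ∩ M := by
  ext i
  simp only [Set.mem_inter_iff, mem_incidenceSet, deleteEdges_inc]
  refine and_congr_left fun hi => and_iff_left_of_imp fun _ => ?_
  have := hM hi
  rw [edgeSet_deleteEdges] at this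
  exact this.2

theorem IsBMatching.of_deleteEdges {S : Set β} (hM : (G.deleteEdges S).IsBMatching b M) :
    G.IsBMatching b M ∧ Disjoint M S := by
  have hsub := hM.1
  rw [edgeSet_deleteEdges] at hsub
  refine ⟨⟨fun i hi => (hsub hi).1, fun v hv => ?_⟩,
    Set.disjoint_left.2 fun i hi => (hsub hi).2⟩
  rw [← incidenceSet_deleteEdges_inter hM.1]
  exact hM.2 v (by simpa using hv)

theorem edgesWithin_deleteEdges (G : Graph α β) (S : Set β) (Z : Set α) :
    (G.deleteEdges S).edgesWithin Z = G.edgesWithin Z \ S := by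
  ext i
  simp only [edgesWithin, deleteEdges_isLink, Set.mem_sdiff, Set.mem_ofPred_eq]
  constructor
  · rintro ⟨x, hx, y, hy, h, hi⟩
    exact ⟨⟨x, hx, y, hy, h⟩, hi⟩
  · rintro ⟨⟨x, hx, y, hy, h⟩, hi⟩
    exact ⟨x, hx, y, hy, h, hi⟩

/-- Strict complementary slackness for an inevitable edge: deleting it lowers the maximum, and an
optimal set for the remaining graph is optimal for `G` as soon as it contains both ends. -/
theorem IsInevitableEdge.exists_isVerifying [Nonempty α] (he : G.IsInevitableEdge b e)
    (hV : V(G).Finite) (hE : E(G).Finite) (hAB : G.IsBipartition A B) :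
    ∃ Z, G.IsVerifying b Z ∧ e ∈ G.edgesWithin Z := by
  obtain ⟨M, -, hM, -, -⟩ := exists_isMaxBMatching_isVerifying hV hE hAB b
  obtain ⟨N, Z, hN, hZ, hle⟩ := exists_isBMatching_verifyingValue_le (G := G.deleteEdges {e})
    (by simpa using hV) (hE.subset (by simp)) (hAB.deleteEdges {e}) b
  obtain ⟨hNG, heN⟩ := hN.of_deleteEdges
  have hlt : N.ncard < M.ncard := by
    by_contra! hcon
    exact Set.disjoint_singleton_right.1 heN
      (he.2 N ⟨hNG, fun K hK => (hM.2 K hK).trans hcon⟩)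
  rw [verifyingValue, edgesWithin_deleteEdges, vertexSet_deleteEdges] at hle
  rw [vertexSet_deleteEdges] at hZ
  have hMZ := (hM.1.ncard_le_verifyingValue_and_iff hV hE hAB Z).1
  have heZ : e ∈ G.edgesWithin Z := by
    by_contra hcon
    rw [Set.sdiff_singleton_eq_self hcon] at hle
    rw [verifyingValue] at hMZ
    omega
  refine ⟨Z, (hM.isVerifying_iff hV hE hAB hZ).2 ?_, heZ⟩
  have := Set.ncard_sdiff_singleton_add_one heZ (hE.subset (G.edgesWithin_subset_edgeSet Z))
  rw [verifyingValue]
  omega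

open Classical in
theorem finsum_mem_eq_finsum_mem_update_add {S : Set α} (hS : S.Finite) (b : α → ℕ) {x y : α}
    (hxy : x ≠ y) (hx : b x ≠ 0) (hy : b y ≠ 0) :
    ∑ᶠ v ∈ S, b v =
      ∑ᶠ v ∈ S, Function.update (Function.update b x (b x - 1)) y (b y - 1) v +
        ((if x ∈ S then 1 else 0) + if y ∈ S then 1 else 0) := by
  obtain ⟨S, rfl⟩ := hS.exists_finset_coe
  rw [finsum_mem_coe_finset, finsum_mem_coe_finset, sum_eq_sum_update_pred_add b hx]
  have hy' : Function.update b x (b x - 1) y = b y := Function.update_of_ne hxy.symm _ _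
  rw [sum_eq_sum_update_pred_add _ (x := y) (by rwa [hy']), hy']
  simp only [Finset.mem_coe]
  ring

theorem IsBMatching.insert_of_update [DecidableEq α] {x y : α} (hxy : x ≠ y)
    (hl : G.IsLink e x y) (hx : b x ≠ 0) (hy : b y ≠ 0)
    (hM : G.IsBMatching (Function.update (Function.update b x (b x - 1)) y (b y - 1)) M) :
    G.IsBMatching b (insert e M) := by
  refine ⟨Set.insert_subset hl.edge_mem hM.1, fun v hv => ?_⟩
  have hv' := hM.2 v hv
  by_cases hev : G.Inc e v
  · rw [Set.inter_insert_of_mem (by simpa using hev)]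
    have hle := Set.ncard_insert_le e (G.incidenceSet v ∩ M)
    rcases hev.eq_or_eq_of_isLink hl with rfl | rfl
    · rw [Function.update_of_ne hxy, Function.update_self] at hv'
      omega
    · rw [Function.update_self] at hv'
      omega
  · rw [Set.inter_insert_of_notMem (by simpa using hev)]
    have h1 : v ≠ x := fun h => hev (h ▸ hl.inc_left)
    have h2 : v ≠ y := fun h => hev (h ▸ hl.inc_right)
    rwa [Function.update_of_ne h2, Function.update_of_ne h1] at hv'

/-- Strict complementary slackness for a forbidden edge: reserving one unit of `b` at each end for it
lowers the maximum by at least two, which forces both ends out of an optimal set for the reduced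
problem. The statement fails if `b` vanishes at an end, since the other end may then be loose. -/
theorem IsForbiddenEdge.exists_isVerifying [Nonempty α] (he : G.IsForbiddenEdge b e)
    (hV : V(G).Finite) (hE : E(G).Finite) (hAB : G.IsBipartition A B) {x y : α} (hxA : x ∈ A)
    (hl : G.IsLink e x y) (hx : b x ≠ 0) (hy : b y ≠ 0) :
    ∃ Z, G.IsVerifying b Z ∧ x ∉ Z ∧ y ∉ Z := by
  classical
  have hxy : x ≠ y := fun h =>
    hAB.disjoint.le_bot ⟨hxA, h ▸ hAB.mem_right_of_isLink hl hxA⟩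
  obtain ⟨M, -, hM, -, -⟩ := exists_isMaxBMatching_isVerifying hV hE hAB b
  -- With `e` added, a `b`-matching of the reduced problem becomes one of `G`; it contains the
  -- forbidden edge `e`, so it is not maximum.
  obtain ⟨N, Z, hN, hZ, hle⟩ := exists_isBMatching_verifyingValue_le (G := G.deleteEdges {e})
    (by simpa using hV) (hE.subset (by simp)) (hAB.deleteEdges {e})
    (Function.update (Function.update b x (b x - 1)) y (b y - 1))
  obtain ⟨hNG, heN⟩ := hN.of_deleteEdges
  rw [Set.disjoint_singleton_right] at heN
  have hins := hNG.insert_of_update hxy hl hx hy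
  have hcard := Set.ncard_insert_of_notMem heN (hE.subset hNG.1)
  have hlt : N.ncard + 1 < M.ncard := by
    by_contra! hcon
    exact he.2 ⟨hl.edge_mem, insert e N,
      ⟨hins, fun K hK => (hM.2 K hK).trans (hcon.trans hcard.ge)⟩, Set.mem_insert e N⟩
  rw [verifyingValue, edgesWithin_deleteEdges, vertexSet_deleteEdges] at hle
  rw [vertexSet_deleteEdges] at hZ
  have hMZ := (hM.1.ncard_le_verifyingValue_and_iff hV hE hAB Z).1
  have hiff := hM.isVerifying_iff hV hE hAB hZ
  have hsum := finsum_mem_eq_finsum_mem_update_add (hV.subset (Set.sdiff_subset (t := Z))) b hxy hx hy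
  have hxV : x ∈ V(G) \ Z ↔ x ∉ Z := ⟨fun h => h.2, fun h => ⟨hl.left_mem, h⟩⟩
  have hyV : y ∈ V(G) \ Z ↔ y ∉ Z := ⟨fun h => h.2, fun h => ⟨hl.right_mem, h⟩⟩
  have hZE := hE.subset (G.edgesWithin_subset_edgeSet Z)
  rw [verifyingValue] at hMZ hiff
  by_cases hxZ : x ∈ Z <;> by_cases hyZ : y ∈ Z <;>
    simp only [hxV, hyV, hxZ, hyZ, not_true_eq_false, not_false_eq_true, if_true, if_false] at hsum
  · have := Set.ncard_sdiff_singleton_add_one (show e ∈ G.edgesWithin Z from ⟨x, hxZ, y, hyZ, hl⟩)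
      hZE
    omega
  all_goals
    have heZ : e ∉ G.edgesWithin Z := by
      rintro ⟨u, hu, w, hw, h⟩
      rcases hl.eq_and_eq_or_eq_and_eq h with ⟨rfl, rfl⟩ | ⟨rfl, rfl⟩ <;> contradiction
    rw [Set.sdiff_singleton_eq_self heZ] at hle
  · omega
  · omega
  · exact ⟨Z, hiff.2 (by omega), hxZ, hyZ⟩

/-! ### Flexible components -/

theorem IsForbiddenEdge.notMem (h : G.IsForbiddenEdge b e) (hM : G.IsMaxBMatching b M) : e ∉ M :=
  fun he => h.2 ⟨h.1, M, hM, he⟩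

theorem isFlexibleEdge_of_not (he : e ∈ E(G)) (h1 : ¬ G.IsForbiddenEdge b e)
    (h2 : ¬ G.IsInevitableEdge b e) : G.IsFlexibleEdge b e :=
  ⟨by_contra fun h => h1 ⟨he, h⟩, h2⟩

theorem isForbiddenEdge_of_eq_zero (hE : E(G).Finite) {y : α} (he : G.Inc e y) (hy : b y = 0) :
    G.IsForbiddenEdge b e := by
  refine ⟨he.edge_mem, ?_⟩
  rintro ⟨-, M, hM, heM⟩
  have h := hM.1.2 y he.vertex_mem
  rw [hy, Nat.le_zero, Set.ncard_eq_zero ((hE.subset hM.1.1).subset Set.inter_subset_right)] at h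
  exact (h ▸ (⟨he, heM⟩ : e ∈ G.incidenceSet y ∩ M) : e ∈ (∅ : Set β))

theorem exists_mem_flexComps {v : α} (hv : v ∈ V(G)) : ∃ C : G.flexComps b, v ∈ V(C.1) :=
  ⟨⟨_, v, hv, rfl⟩, hv, Relation.ReflTransGen.refl⟩

theorem vertexSet_subset_of_mem_flexComps (C : G.flexComps b) : V(C.1) ⊆ V(G) := by
  obtain ⟨C, x, hx, rfl⟩ := C
  exact fun y hy => hy.1

theorem nonempty_of_mem_flexComps (C : G.flexComps b) : V(C.1).Nonempty := by
  obtain ⟨C, x, hx, rfl⟩ := C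
  exact ⟨x, hx, Relation.ReflTransGen.refl⟩

theorem reflTransGen_of_mem_flexComps (C : G.flexComps b) {x y : α} (hx : x ∈ V(C.1))
    (hy : y ∈ V(C.1)) :
    Relation.ReflTransGen (G.restrict {e | G.IsFlexibleEdge b e}).Adj x y := by
  obtain ⟨C, z, hz, rfl⟩ := C
  exact (Std.Symm.symm _ _ hx.2).trans hy.2

theorem flexComps_eq_of_reflTransGen (C D : G.flexComps b) {x y : α} (hx : x ∈ V(C.1))
    (hy : y ∈ V(D.1))
    (h : Relation.ReflTransGen (G.restrict {e | G.IsFlexibleEdge b e}).Adj x y) : C = D := by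
  obtain ⟨C, z, hz, rfl⟩ := C
  obtain ⟨D, w, hw, rfl⟩ := D
  have hzw := (hx.2.trans h).trans (Std.Symm.symm _ _ hy.2)
  refine Subtype.ext (congrArg G.induce (Set.ext fun v => and_congr_right fun _ => ?_))
  exact ⟨fun hv => (Std.Symm.symm _ _ hzw).trans hv, fun hv => hzw.trans hv⟩

theorem flexComps_eq_of_mem (C D : G.flexComps b) {x : α} (hx : x ∈ V(C.1)) (hy : x ∈ V(D.1)) :
    C = D :=
  flexComps_eq_of_reflTransGen C D hx hy Relation.ReflTransGen.refl

theorem flexComps_eq_of_isFlexibleEdge (C D : G.flexComps b) {x y : α} (hx : x ∈ V(C.1))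
    (hy : y ∈ V(D.1)) (hl : G.IsLink e x y) (he : G.IsFlexibleEdge b e) : C = D :=
  flexComps_eq_of_reflTransGen C D hx hy (Relation.ReflTransGen.single ⟨e, by simpa using ⟨he, hl⟩⟩)

/-! ### Slack cuts and the partial order -/

/-- A cut such that every edge from `X ∩ A` to the complement of `X` is inevitable and every edge from
`A \ X` to `X` is forbidden. In a bipartite graph no other edge crosses the cut. -/
structure IsSlackCut (G : Graph α β) (b : α → ℕ) (A X : Set α) : Prop where
  isInevitableEdge : ∀ e x y, G.IsLink e x y → x ∈ A → x ∈ X → y ∉ X → G.IsInevitableEdge b e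
  isForbiddenEdge : ∀ e x y, G.IsLink e x y → x ∈ A → x ∉ X → y ∈ X → G.IsForbiddenEdge b e

theorem IsSlackCut.mem_iff_of_isFlexibleEdge (hX : G.IsSlackCut b A X)
    (hAB : G.IsBipartition A B) (he : G.IsFlexibleEdge b e) {x y : α} (hl : G.IsLink e x y) :
    x ∈ X ↔ y ∈ X := by
  have key : ∀ {u w}, G.IsLink e u w → u ∈ A → (u ∈ X ↔ w ∈ X) := by
    intro u w h hu
    by_contra hne
    by_cases hw : w ∈ X
    · exact (hX.isForbiddenEdge e u w h hu (by tauto) hw).2 he.1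
    · exact he.2 (hX.isInevitableEdge e u w h hu (by tauto) hw)
  have hx := hl.left_mem
  rw [← hAB.union_eq] at hx
  rcases hx with hx | hx
  · exact key hl hx
  · exact (key hl.symm (hAB.mem_left_of_isLink hl hx)).symm

/-- A slack cut is a union of flexible components. -/
theorem IsSlackCut.subset_of_mem (hX : G.IsSlackCut b A X) (hAB : G.IsBipartition A B)
    (C : G.flexComps b) {x : α} (hx : x ∈ V(C.1)) (hxX : x ∈ X) : V(C.1) ⊆ X := by
  intro y hy
  induction reflTransGen_of_mem_flexComps C hx hy with
  | refl => exact hxX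
  | tail hxv hvw ih =>
    obtain ⟨i, hi⟩ := hvw
    rw [restrict_isLink] at hi
    have hv := vertexSet_subset_of_mem_flexComps C hx
    obtain ⟨D, hD⟩ := exists_mem_flexComps (b := b) hi.2.left_mem
    obtain rfl := flexComps_eq_of_reflTransGen C D hx hD hxv
    exact (hX.mem_iff_of_isFlexibleEdge hAB hi.1 hi.2).1 (ih hD)

theorem IsSlackCut.subset_of_flexStep (hX : G.IsSlackCut b A X) (hAB : G.IsBipartition A B)
    {C D : G.flexComps b} (h : G.FlexStep b A C D) (hD : V(D.1) ⊆ X) : V(C.1) ⊆ X := by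
  rcases h with rfl | ⟨e, he, x, hx, y, hy, hl⟩ | ⟨e, he, x, hx, y, hy, hl⟩
  · exact hD
  · refine hX.subset_of_mem hAB C hx.1 (by_contra fun hxX => ?_)
    exact (hX.isForbiddenEdge e x y hl hx.2 hxX (hD hy.1)).2 he.1
  · refine hX.subset_of_mem hAB C hy.1 (by_contra fun hyX => ?_)
    exact he.2 (hX.isInevitableEdge e x y hl hx.2 (hD hx.1) hyX).1

theorem IsSlackCut.subset_of_flexLE (hX : G.IsSlackCut b A X) (hAB : G.IsBipartition A B)
    {C D : G.flexComps b} (h : G.FlexLE b A C D) (hD : V(D.1) ⊆ X) : V(C.1) ⊆ X := by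
  induction h using Relation.ReflTransGen.head_induction_on with
  | refl => exact hD
  | head h _ ih => exact hX.subset_of_flexStep hAB h ih

theorem IsVerifying.isSlackCut [Nonempty α] (hZ : G.IsVerifying b Z) (hV : V(G).Finite)
    (hE : E(G).Finite) (hAB : G.IsBipartition A B) : G.IsSlackCut b A (A ∩ Z ∪ B \ Z) := by
  obtain ⟨M, -, hM, -, -⟩ := exists_isMaxBMatching_isVerifying hV hE hAB b
  have hs := fun {N} (hN : G.IsMaxBMatching b N) =>
    (hN.isVerifying_iff_slackness hV hE hAB hZ.1).1 hZ
  have hd : ∀ v ∈ A, v ∉ B := fun v h h' => hAB.disjoint.le_bot ⟨h, h'⟩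
  constructor
  · intro e x y hl hxA hx hy
    have hyB := hAB.mem_right_of_isLink hl hxA
    have hxB := hd x hxA
    simp only [Set.mem_union, Set.mem_inter_iff, Set.mem_sdiff] at hx hy
    have heZ : e ∈ G.edgesWithin Z := ⟨x, by tauto, y, by tauto, hl⟩
    exact ⟨⟨hl.edge_mem, M, hM, (hs hM).2.1 heZ⟩, fun N hN => (hs hN).2.1 heZ⟩
  · intro e x y hl hxA hx hy
    have hyB := hAB.mem_right_of_isLink hl hxA
    have hyA : y ∉ A := fun h => hd y h hyB
    simp only [Set.mem_union, Set.mem_inter_iff, Set.mem_sdiff] at hx hy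
    refine ⟨hl.edge_mem, ?_⟩
    rintro ⟨-, N, hN, heN⟩
    have := (hs hN).2.2 e heN x y hl
    tauto

/-- The two components of a nontrivial step are separated by a slack cut. -/
theorem exists_isSlackCut_of_flexStep [Nonempty α] (hV : V(G).Finite) (hE : E(G).Finite)
    (hAB : G.IsBipartition A B) {C D : G.flexComps b} (h : G.FlexStep b A C D) (hne : C ≠ D) :
    ∃ X, G.IsSlackCut b A X ∧ V(C.1) ⊆ X ∧ ¬ V(D.1) ⊆ X := by
  have hd : ∀ v ∈ A, v ∉ B := fun v h h' => hAB.disjoint.le_bot ⟨h, h'⟩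
  suffices ∃ X, G.IsSlackCut b A X ∧ (V(C.1) ∩ X).Nonempty ∧ ¬ V(D.1) ⊆ X by
    obtain ⟨X, hX, ⟨v, hvC, hvX⟩, hD⟩ := this
    exact ⟨X, hX, hX.subset_of_mem hAB C hvC hvX, hD⟩
  rcases h with h | ⟨e, he, x, hx, y, hy, hl⟩ | ⟨e, he, x, hx, y, hy, hl⟩
  · exact absurd h hne
  · obtain ⟨Z, hZ, u, hu, w, hw, hl'⟩ := he.exists_isVerifying hV hE hAB
    have hxy : x ∈ Z ∧ y ∈ Z := by
      rcases hl.eq_and_eq_or_eq_and_eq hl' with ⟨rfl, rfl⟩ | ⟨rfl, rfl⟩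
      · exact ⟨hu, hw⟩
      · exact ⟨hw, hu⟩
    exact ⟨_, hZ.isSlackCut hV hE hAB, ⟨x, hx.1, Or.inl ⟨hx.2, hxy.1⟩⟩, fun h =>
      (h hy.1).elim (fun h => hy.2 h.1) (fun h => h.2 hxy.2)⟩
  · have hyB := hAB.mem_right_of_isLink hl hx.2
    -- The component of an `A`-vertex with `b x = 0` is maximal, that of a `B`-vertex with `b y = 0` is
    -- minimal, because all edges at such a vertex are forbidden.
    by_cases hx0 : b x = 0
    · refine ⟨V(G) \ {x}, ⟨fun i u w hi huA hu hw => ?_, fun i u w hi huA hu hw => ?_⟩,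
        ⟨y, hy.1, hl.right_mem, fun h => hy.2 (h ▸ hx.2)⟩, fun h => (h hx.1).2 rfl⟩
      · have hwx : w = x := by_contra fun h => hw ⟨hi.right_mem, h⟩
        exact (hd x hx.2 (hwx ▸ hAB.mem_right_of_isLink hi huA)).elim
      · have hux : u = x := by_contra fun h => hu ⟨hi.left_mem, h⟩
        exact isForbiddenEdge_of_eq_zero hE hi.inc_left (hux ▸ hx0)
    by_cases hy0 : b y = 0
    · refine ⟨{y}, ⟨fun i u w hi huA hu hw => ?_, fun i u w hi huA hu hw => ?_⟩,
        ⟨y, hy.1, rfl⟩, fun h => hy.2 (h hx.1 ▸ hx.2)⟩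
      · exact (hy.2 (hu ▸ huA)).elim
      · exact isForbiddenEdge_of_eq_zero hE hi.inc_right (hw ▸ hy0)
    obtain ⟨Z, hZ, hxZ, hyZ⟩ := he.exists_isVerifying hV hE hAB hx.2 hl hx0 hy0
    exact ⟨_, hZ.isSlackCut hV hE hAB, ⟨y, hy.1, Or.inr ⟨hyB, hyZ⟩⟩, fun h =>
      (h hx.1).elim (fun h => hxZ h.2) (fun h => hd x hx.2 h.1)⟩

theorem isPartialOrder_flexLE [Nonempty α] (hV : V(G).Finite) (hE : E(G).Finite)
    (hAB : G.IsBipartition A B) (b : α → ℕ) :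
    IsPartialOrder (G.flexComps b) (G.FlexLE b A) where
  refl _ := Relation.ReflTransGen.refl
  trans _ _ _ := Relation.ReflTransGen.trans
  antisymm C D hCD hDC := by
    induction hCD using Relation.ReflTransGen.head_induction_on with
    | refl => rfl
    | @head C C' hstep hC'D ih =>
      by_cases hne : C = C'
      · subst hne; exact ih hDC
      · obtain ⟨X, hX, hCX, hC'X⟩ := exists_isSlackCut_of_flexStep hV hE hAB hstep hne
        exact (hC'X (hX.subset_of_flexLE hAB (hC'D.trans hDC) hCX)).elim

/-! ### Verifying sets and normalized ideals -/

/-- Inconsistency is implied by being hooked up: a vertex with `b v = 0` is never loose, so being a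
neighbour of the loose vertices in `W` makes it a neighbour of the loose vertices. -/
theorem inconsistentHookedUpBy_iff {W : Set α} {C : G.flexComps b} :
    C ∈ G.inconsistentHookedUpBy b W ↔ (V(C.1) ∩ G.looseVertices b ∩ W).Nonempty ∨
      ∃ v, V(C.1) = {v} ∧ b v = 0 ∧ v ∈ G.neighbours (G.looseVertices b ∩ W) := by
  constructor
  · rintro ⟨-, h | h⟩
    · exact Or.inl h.2
    · exact Or.inr h
  · rintro (h | ⟨v, hv, hb, hvW, x, hx, hxv⟩)
    · have hl : G.IsLooseSubgraph b C.1 := h.mono Set.inter_subset_left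
      exact ⟨Or.inl hl, Or.inl ⟨hl, h⟩⟩
    · refine ⟨Or.inr ⟨v, hv, hb, fun hvl => ?_, x, hx.1, hxv⟩,
        Or.inr ⟨v, hv, hb, hvW, x, hx, hxv⟩⟩
      obtain ⟨-, M, -, hM⟩ := hvl
      omega

theorem mem_projectiveUnion_iff {I : Set (G.flexComps b)} {W : Set α} {v : α} :
    v ∈ projectiveUnion (Subtype.val '' I) W ↔ ∃ C ∈ I, v ∈ V(C.1) ∧ v ∈ W := by
  simp only [projectiveUnion, Set.biUnion_image, Set.mem_iUnion₂, Set.mem_inter_iff, exists_prop]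

theorem IsVerifying.looseVertices_subset [Nonempty α] (hZ : G.IsVerifying b Z) (hV : V(G).Finite)
    (hE : E(G).Finite) (hAB : G.IsBipartition A B) : G.looseVertices b ⊆ Z := by
  rintro v ⟨hv, M, hM, hlt⟩
  by_contra hvZ
  exact hlt.ne (((hM.isVerifying_iff_slackness hV hE hAB hZ.1).1 hZ).1 v ⟨hv, hvZ⟩)

/-- The loose neighbour belongs to `Z`, so `v ∈ Z` would put a forbidden edge into `E[Z]`. -/
theorem IsVerifying.notMem_of_adj_looseVertices [Nonempty α] (hZ : G.IsVerifying b Z)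
    (hV : V(G).Finite) (hE : E(G).Finite) (hAB : G.IsBipartition A B) {u v : α}
    (hu : u ∈ G.looseVertices b) (hv : b v = 0) (huv : G.Adj u v) : v ∉ Z := by
  intro hvZ
  obtain ⟨e, he⟩ := huv
  obtain ⟨M, -, hM, -, -⟩ := exists_isMaxBMatching_isVerifying hV hE hAB b
  exact (isForbiddenEdge_of_eq_zero hE he.inc_right hv).notMem hM
    (((hM.isVerifying_iff_slackness hV hE hAB hZ.1).1 hZ).2.1
      ⟨u, hZ.looseVertices_subset hV hE hAB hu, v, hvZ, he⟩)

/-- The ideals consist of the components inside and outside the slack cut of `Z`. -/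
theorem IsVerifying.exists_ideals [Nonempty α] (hZ : G.IsVerifying b Z) (hV : V(G).Finite)
    (hE : E(G).Finite) (hAB : G.IsBipartition A B) :
    ∃ I J : Set (G.flexComps b),
      G.IsNormalizedLowerIdeal b A B I ∧ G.IsNormalizedUpperIdeal b A B J ∧
      Disjoint I J ∧ I ∪ J = Set.univ ∧
      Disjoint (projectiveUnion (Subtype.val '' I) A) (projectiveUnion (Subtype.val '' J) B) ∧
      Z = projectiveUnion (Subtype.val '' I) A ∪ projectiveUnion (Subtype.val '' J) B := by
  have hX := hZ.isSlackCut hV hE hAB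
  have hd : ∀ v ∈ A, v ∉ B := fun v h h' => hAB.disjoint.le_bot ⟨h, h'⟩
  set X := A ∩ Z ∪ B \ Z with hXdef
  have hXA : ∀ v ∈ A, (v ∈ X ↔ v ∈ Z) := fun v hv => by
    have := hd v hv
    simp only [hXdef, Set.mem_union, Set.mem_inter_iff, Set.mem_sdiff]
    tauto
  have hXB : ∀ v ∈ B, (v ∈ X ↔ v ∉ Z) := fun v hv => by
    have := fun h => hd v h hv
    simp only [hXdef, Set.mem_union, Set.mem_inter_iff, Set.mem_sdiff]
    tauto
  have hlower : ∀ C D : G.flexComps b, G.FlexLE b A C D → V(D.1) ⊆ X → V(C.1) ⊆ X :=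
    fun C D h => hX.subset_of_flexLE hAB h
  have hNA : ∀ C ∈ G.inconsistentHookedUpBy b A, V(C.1) ⊆ X := by
    intro C hC
    rcases inconsistentHookedUpBy_iff.1 hC with ⟨v, ⟨hvC, hvl⟩, hvA⟩ | ⟨v, hvC, hb, -, x, hx, hxv⟩
    · exact hX.subset_of_mem hAB C hvC
        ((hXA v hvA).2 (hZ.looseVertices_subset hV hE hAB hvl))
    · rw [hvC, Set.singleton_subset_iff]
      obtain ⟨e, he⟩ := id hxv
      exact (hXB v (hAB.mem_right_of_isLink he hx.2)).2
        (hZ.notMem_of_adj_looseVertices hV hE hAB hx.1 hb hxv)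
  have hNB : ∀ C ∈ G.inconsistentHookedUpBy b B, ¬ V(C.1) ⊆ X := by
    intro C hC hCX
    rcases inconsistentHookedUpBy_iff.1 hC with ⟨v, ⟨hvC, hvl⟩, hvB⟩ | ⟨v, hvC, hb, -, x, hx, hxv⟩
    · exact (hXB v hvB).1 (hCX hvC) (hZ.looseVertices_subset hV hE hAB hvl)
    · rw [hvC, Set.singleton_subset_iff] at hCX
      obtain ⟨e, he⟩ := id hxv
      exact hZ.notMem_of_adj_looseVertices hV hE hAB hx.1 hb hxv
        ((hXA v (hAB.mem_left_of_isLink he hx.2)).1 hCX)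
  have hZA : projectiveUnion (Subtype.val '' {C : G.flexComps b | V(C.1) ⊆ X}) A = A ∩ Z := by
    ext v
    rw [mem_projectiveUnion_iff]
    constructor
    · rintro ⟨C, hC, hvC, hvA⟩
      exact ⟨hvA, (hXA v hvA).1 (hC hvC)⟩
    · rintro ⟨hvA, hvZ⟩
      obtain ⟨C, hC⟩ := exists_mem_flexComps (b := b) (hZ.1 hvZ)
      exact ⟨C, hX.subset_of_mem hAB C hC ((hXA v hvA).2 hvZ), hC, hvA⟩
  have hZB : projectiveUnion (Subtype.val '' {C : G.flexComps b | ¬ V(C.1) ⊆ X}) B = B ∩ Z := by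
    ext v
    rw [mem_projectiveUnion_iff]
    constructor
    · rintro ⟨C, hC, hvC, hvB⟩
      refine ⟨hvB, by_contra fun hvZ => ?_⟩
      exact hC (hX.subset_of_mem hAB C hvC ((hXB v hvB).2 hvZ))
    · rintro ⟨hvB, hvZ⟩
      obtain ⟨C, hC⟩ := exists_mem_flexComps (b := b) (hZ.1 hvZ)
      exact ⟨C, fun h => (hXB v hvB).1 (h hC) hvZ, hC, hvB⟩
  refine ⟨{C | V(C.1) ⊆ X}, {C | ¬ V(C.1) ⊆ X}, ⟨hlower, hNA, ?_⟩,
    ⟨fun C D h hC hD => hC (hlower C D h hD), ?_, hNB⟩, ?_, ?_, ?_, ?_⟩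
  · exact Set.eq_empty_of_forall_notMem fun C hC => hNB C hC.1 hC.2
  · exact Set.eq_empty_of_forall_notMem fun C hC => hC.2 (hNA C hC.1)
  · exact Set.disjoint_left.2 fun C h h' => h' h
  · exact Set.eq_univ_of_forall fun C => em _
  · rw [hZA, hZB]
    exact hAB.disjoint.mono Set.inter_subset_left Set.inter_subset_left
  · rw [hZA, hZB, ← Set.union_inter_distrib_right, hAB.union_eq, Set.inter_eq_right.2 hZ.1]

/-- A complementary pair of normalized ideals yields a set satisfying complementary slackness for any
maximum `b`-matching. -/
theorem isVerifying_of_ideals [Nonempty α] (hV : V(G).Finite) (hE : E(G).Finite)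
    (hAB : G.IsBipartition A B) {I J : Set (G.flexComps b)}
    (hI : G.IsNormalizedLowerIdeal b A B I) (hJ : G.IsNormalizedUpperIdeal b A B J)
    (hIJ : Disjoint I J) (hun : I ∪ J = Set.univ) :
    G.IsVerifying b
      (projectiveUnion (Subtype.val '' I) A ∪ projectiveUnion (Subtype.val '' J) B) := by
  have hd : ∀ v ∈ A, v ∉ B := fun v h h' => hAB.disjoint.le_bot ⟨h, h'⟩
  have hJI : ∀ C, C ∈ J ↔ C ∉ I := fun C =>
    ⟨fun h h' => Set.disjoint_left.1 hIJ h' h,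
      fun h => ((Set.eq_univ_iff_forall.1 hun C).resolve_left h)⟩
  set Z := projectiveUnion (Subtype.val '' I) A ∪ projectiveUnion (Subtype.val '' J) B with hZ
  have hZA : ∀ {C : G.flexComps b} {v}, v ∈ V(C.1) → v ∈ A → (v ∈ Z ↔ C ∈ I) := by
    intro C v hv hvA
    rw [hZ, Set.mem_union, mem_projectiveUnion_iff, mem_projectiveUnion_iff]
    constructor
    · rintro (⟨D, hD, hvD, -⟩ | ⟨D, -, -, hvB⟩)
      · rwa [flexComps_eq_of_mem C D hv hvD]
      · exact (hd v hvA hvB).elim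
    · exact fun hC => Or.inl ⟨C, hC, hv, hvA⟩
  have hZB : ∀ {C : G.flexComps b} {v}, v ∈ V(C.1) → v ∈ B → (v ∈ Z ↔ C ∉ I) := by
    intro C v hv hvB
    rw [hZ, Set.mem_union, mem_projectiveUnion_iff, mem_projectiveUnion_iff, ← hJI]
    constructor
    · rintro (⟨D, -, -, hvA⟩ | ⟨D, hD, hvD, -⟩)
      · exact (hd v hvA hvB).elim
      · rwa [flexComps_eq_of_mem C D hv hvD]
    · exact fun hC => Or.inr ⟨C, hC, hv, hvB⟩
  have hZV : Z ⊆ V(G) := by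
    rintro v (hv | hv) <;> obtain ⟨C, -, hv, -⟩ := mem_projectiveUnion_iff.1 hv <;>
      exact vertexSet_subset_of_mem_flexComps C hv
  obtain ⟨M, -, hM, -, -⟩ := exists_isMaxBMatching_isVerifying hV hE hAB b
  rw [hM.isVerifying_iff_slackness hV hE hAB hZV]
  refine ⟨fun v hv => ?_, fun e he => ?_, fun e heM => ?_⟩
  · by_contra hne
    have hvl : v ∈ G.looseVertices b := ⟨hv.1, M, hM, (hM.1.2 v hv.1).lt_of_ne hne⟩
    obtain ⟨C, hC⟩ := exists_mem_flexComps (b := b) hv.1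
    have hvAB := hv.1
    rw [← hAB.union_eq] at hvAB
    rcases hvAB with hvA | hvB
    · exact hv.2 ((hZA hC hvA).2
        (hI.subset (inconsistentHookedUpBy_iff.2 (Or.inl ⟨v, ⟨hC, hvl⟩, hvA⟩))))
    · exact hv.2 ((hZB hC hvB).2 ((hJI C).1
        (hJ.subset (inconsistentHookedUpBy_iff.2 (Or.inl ⟨v, ⟨hC, hvl⟩, hvB⟩)))))
  · obtain ⟨x, hx, y, hy, hl⟩ := hAB.exists_isLink e (G.edgesWithin_subset_edgeSet Z he)
    obtain ⟨C, hC⟩ := exists_mem_flexComps (b := b) hl.left_mem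
    obtain ⟨D, hD⟩ := exists_mem_flexComps (b := b) hl.right_mem
    have hxy : x ∈ Z ∧ y ∈ Z := by
      obtain ⟨u, hu, w, hw, hl'⟩ := he
      rcases hl.eq_and_eq_or_eq_and_eq hl' with ⟨rfl, rfl⟩ | ⟨rfl, rfl⟩
      · exact ⟨hu, hw⟩
      · exact ⟨hw, hu⟩
    have hCI := (hZA hC hx).1 hxy.1
    have hDI := (hZB hD hy).1 hxy.2
    by_contra heM
    by_cases hf : G.IsForbiddenEdge b e
    · exact hDI (hI.lower D C (Relation.ReflTransGen.single
        (Or.inr (Or.inr ⟨e, hf, x, ⟨hC, hx⟩, y, ⟨hD, fun h => hd y h hy⟩, hl⟩))) hCI)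
    · exact hDI (flexComps_eq_of_isFlexibleEdge C D hC hD hl
        (isFlexibleEdge_of_not hl.edge_mem hf fun h => heM (h.2 M hM)) ▸ hCI)
  · suffices h : ∀ x y, G.IsLink e x y → x ∈ A → x ∈ Z ∨ y ∈ Z by
      intro x y hl
      have hx := hl.left_mem
      rw [← hAB.union_eq] at hx
      rcases hx with hx | hx
      · exact h x y hl hx
      · exact (h y x hl.symm (hAB.mem_left_of_isLink hl hx)).symm
    intro x y hl hx
    have hy := hAB.mem_right_of_isLink hl hx
    obtain ⟨C, hC⟩ := exists_mem_flexComps (b := b) hl.left_mem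
    obtain ⟨D, hD⟩ := exists_mem_flexComps (b := b) hl.right_mem
    by_contra! hcon
    have hCI := mt (hZA hC hx).2 hcon.1
    have hDI := not_not.1 (mt (hZB hD hy).2 hcon.2)
    by_cases hf : G.IsInevitableEdge b e
    · exact hCI (hI.lower C D (Relation.ReflTransGen.single
        (Or.inr (Or.inl ⟨e, hf, x, ⟨hC, hx⟩, y, ⟨hD, fun h => hd y h hy⟩, hl⟩))) hDI)
    · exact hCI (flexComps_eq_of_isFlexibleEdge C D hC hD hl
        (isFlexibleEdge_of_not hl.edge_mem (fun h => h.notMem hM heM) hf) ▸ hDI)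

end Graph

theorem mainTheorem1 {α β : Type*} (G : Graph α β) (hV : V(G).Finite) (hE : E(G).Finite)
    (A B : Set α) (hAB : G.IsBipartition A B) (b : α → ℕ) :
    IsPartialOrder (G.flexComps b) (G.FlexLE b A) ∧
    ∀ Z : Set α, G.IsVerifying b Z ↔
      ∃ I J : Set (G.flexComps b),
        G.IsNormalizedLowerIdeal b A B I ∧ G.IsNormalizedUpperIdeal b A B J ∧
        Disjoint I J ∧ I ∪ J = Set.univ ∧
        Disjoint (Graph.projectiveUnion (Subtype.val '' I) A)
          (Graph.projectiveUnion (Subtype.val '' J) B) ∧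
        Z = Graph.projectiveUnion (Subtype.val '' I) A ∪
          Graph.projectiveUnion (Subtype.val '' J) B := by
  -- Ends of edges can be chosen as functions on all of `β` only if there is a vertex.
  rcases isEmpty_or_nonempty α with hα | hα
  · have hC : IsEmpty (G.flexComps b) := ⟨fun C => (Graph.nonempty_of_mem_flexComps C).elim
      fun v _ => hα.elim v⟩
    refine ⟨{ refl := isEmptyElim, trans := isEmptyElim, antisymm := isEmptyElim }, fun Z => ?_⟩
    refine iff_of_true ⟨fun v => hα.elim v, fun Y _ => (congrArg _ (Subsingleton.elim Z Y)).le⟩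
      ⟨∅, ∅, ⟨isEmptyElim, isEmptyElim, Subsingleton.elim _ _⟩,
        ⟨isEmptyElim, Subsingleton.elim _ _, isEmptyElim⟩, disjoint_bot_left,
        Subsingleton.elim _ _, Set.disjoint_left.2 fun v => hα.elim v, Subsingleton.elim _ _⟩
  · refine ⟨Graph.isPartialOrder_flexLE hV hE hAB b, fun Z => ⟨fun hZ =>
      hZ.exists_ideals hV hE hAB, ?_⟩⟩
    rintro ⟨I, J, hI, hJ, hIJ, hun, -, rfl⟩
    exact Graph.isVerifying_of_ideals hV hE hAB hI hJ hIJ hun
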